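/- **Setting.** Let $V$ and $W$ be connected Hausdorff $C^\infty$ manifolds of the same dimension $n$, each with a $C^1$ metric $\mathbf g$ of Lorentzian signature $(+,-,\dots,-)$ and a time orientation given by a continuous timelike vector field $\xi$. A tangent vector $v$ is *future-directed* if $\mathbf g(v,v)\ge 0$ and $\mathbf g(\xi,v)>0$, and *timelike* if $\mathbf g(v,v)>0$. Write $V\prec W$ ("$W$ is causally related with $V$") if there is a $C^\infty$ diffeomorphism $\Phi:V\to W$ such that $\Phi' X$ is future-directed for every future-directed $X\in T(V)$. **Curves.** A timelike curve is a piecewise $C^1$ curve (finitely many arcs on closed intervals) whose tangent vectors, one-sided ones at corners included, are future-directed and timelike. A causal curve is a continuous curve $\gamma$ on an interval such that for every parameter $t$ and every neighbourhood $U$ of $\gamma(t)$, for all $t_1<t_2$ sufficiently close to $t$ there is a $C^1$ arc in $U$ with future-directed tangent vectors from $\gamma(t_1)$ to $\gamma(t_2)$. A point $x$ is a past (future) endpoint of $\gamma$ if for every neighbourhood $U$ of $x$ there is a parameter $t_0$ with $\gamma(t)\in U$ for all $t\le t_0$ ($t\ge t_0$); $\gamma$ is past (future) endless if it has no past (future)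 endpoint. $I^{+}(x)$ is the set of points reached from $x$ by a timelike curve, $J^{+}(x)$ consists of $x$ and the points reached from $x$ by a causal curve on an interval $[a,b]$, $a<b$; $I^-$, $J^-$ are defined dually, and $I^\pm(x,U)$ uses timelike curves in $U$. $D^{+}(S)$ is the set of $x$ such that every past-endless causal curve through $x$ meets $S$; $D^-(S)$ is defined dually with future-endless curves, and $D(S)=D^+(S)\cup D^-(S)$. A set $S$ is acausal if no causal curve on an interval $[a,b]$, $a<b$, starts and ends in $S$. The edge of $S$ is the set of $x\in\overline S$ such that every neighbourhood $U$ of $x$ contains $p\in I^-(x,U)$ and $q\in I^+(x,U)$ joined by a timelike curve in $U\setminus S$. **Causality conditions.** A manifold $V$ as above is - *not totally vicious* if $I^+(x)\cap I^-(x)\ne V$ for all $x$; - *chronological* if $x\notin I^+(x)$ for all $x$; - *causal* if $J^+(x)\cap J^-(x)=\{x\}$ for all $x$; - *distinguishing* if $I^+(x)=I^+(y)$ implies $x=y$, and $I^-(x)=I^-(y)$ implies $x=y$; - *strongly causal* if every neighbourhood of every point $x$ contains a neighbourhood $U$ of $x$ such that $\gamma\cap U$ is empty or connected for every causal curve $\gamma$;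 - *causally stable* if there is a smooth function on $V$ whose gradient is everywhere timelike; - *globally hyperbolic* if there is an acausal (topological, locally flat) hypersurface $S$ with empty edge and $D(S)=V$. **Theorem.** If $V\prec W$ and $W$ is globally hyperbolic (respectively causally stable, strongly causal, distinguishing, causal, chronological, not totally vicious), then so is $V$. Consequently, if $W$ satisfies one of these seven conditions and $V$ does not, then $V\not\prec W$. -/

import Mathlib

open Set Bundle
open scoped Manifold ContDiff Topology

noncomputable section

/-- A time-oriented Lorentzian structure on a smooth manifold `V` of dimension `n`: a `C^1` metric
of signature `(+,-,…,-)` and a continuous timelike vector field giving the time orientation. -/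
structure Spacetime (n : ℕ) (V : Type*) [TopologicalSpace V]
    [ChartedSpace (EuclideanSpace ℝ (Fin n)) V] [IsManifold (𝓡 n) ∞ V] where
  /-- the metric tensor -/
  metric : ∀ x : V, TangentSpace (𝓡 n) x →L[ℝ] TangentSpace (𝓡 n) x →L[ℝ] ℝ
  symm : ∀ (x : V) (v w : TangentSpace (𝓡 n) x), metric x v w = metric x w v
  /-- signature `(+,-,…,-)`: some positive vector has a negative definite orthogonal complement -/
  lorentzian : ∀ x : V, ∃ v : TangentSpace (𝓡 n) x, 0 < metric x v v ∧
    ∀ w : TangentSpace (𝓡 n) x, metric x v w = 0 → w ≠ 0 → metric x w w < 0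
  contMDiff_metric : ContMDiff (𝓡 n)
    ((𝓡 n).prod 𝓘(ℝ, EuclideanSpace ℝ (Fin n) →L[ℝ] EuclideanSpace ℝ (Fin n) →L[ℝ] ℝ)) 1
    (fun x ↦ TotalSpace.mk' (EuclideanSpace ℝ (Fin n) →L[ℝ] EuclideanSpace ℝ (Fin n) →L[ℝ] ℝ)
      (E := fun y : V ↦ TangentSpace (𝓡 n) y →L[ℝ] TangentSpace (𝓡 n) y →L[ℝ] ℝ) x (metric x))
  /-- the vector field defining the time orientation -/
  timeField : ∀ x : V, TangentSpace (𝓡 n) x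
  timelike_timeField : ∀ x : V, 0 < metric x (timeField x) (timeField x)
  continuous_timeField :
    Continuous (fun x ↦ (⟨x, timeField x⟩ : TangentBundle (𝓡 n) V))

namespace Spacetime

variable {n : ℕ} {V : Type*} [TopologicalSpace V]
  [ChartedSpace (EuclideanSpace ℝ (Fin n)) V] [IsManifold (𝓡 n) ∞ V] (g : Spacetime n V)

/-! ### Vectors -/

/-- Future-directed (causal) tangent vectors. -/
def IsFuture {x : V} (v : TangentSpace (𝓡 n) x) : Prop :=
  0 ≤ g.metric x v v ∧ 0 < g.metric x (g.timeField x) v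

/-- Future-directed timelike tangent vectors. -/
def IsFutureTimelike {x : V} (v : TangentSpace (𝓡 n) x) : Prop :=
  0 < g.metric x v v ∧ 0 < g.metric x (g.timeField x) v

/-! ### Curves -/

/-- The tangent vector at time `t` of a curve restricted to `[a, b]`
(one-sided at the end points). -/
def velocity (n : ℕ) {V : Type*} [TopologicalSpace V]
    [ChartedSpace (EuclideanSpace ℝ (Fin n)) V] (γ : ℝ → V) (a b t : ℝ) :
    TangentSpace (𝓡 n) (γ t) :=
  mfderivWithin 𝓘(ℝ, ℝ) (𝓡 n) γ (Icc a b) t (1 : ℝ)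

/-- `γ` restricted to `[a, b]` is a `C^1` future-directed causal arc. -/
def IsCausalArc (γ : ℝ → V) (a b : ℝ) : Prop :=
  a < b ∧ ContMDiffOn 𝓘(ℝ, ℝ) (𝓡 n) 1 γ (Icc a b) ∧
    ∀ t ∈ Icc a b, g.IsFuture (velocity n γ a b t)

/-- `γ` restricted to `[a, b]` is a `C^1` future-directed timelike arc. -/
def IsTimelikeArc (γ : ℝ → V) (a b : ℝ) : Prop :=
  a < b ∧ ContMDiffOn 𝓘(ℝ, ℝ) (𝓡 n) 1 γ (Icc a b) ∧
    ∀ t ∈ Icc a b, g.IsFutureTimelike (velocity n γ a b t)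

/-- `γ` restricted to `[a, b]` is a piecewise `C^1` future-directed timelike curve:
`[a, b]` is cut at `a = τ 0 < τ 1 < ⋯ < τ k = b` into finitely many timelike arcs. -/
def IsTimelikeCurve (γ : ℝ → V) (a b : ℝ) : Prop :=
  a < b ∧ ∃ (k : ℕ) (τ : ℕ → ℝ), τ 0 = a ∧ τ k = b ∧
    ∀ i < k, g.IsTimelikeArc γ (τ i) (τ (i + 1))

/-- `γ` restricted to the interval `s` is a continuous future-directed causal curve: locally along
the curve, and inside arbitrarily small open sets, an earlier point is joined to a later one by a
`C^1` future-directed causal arc. -/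
def IsCausalCurve (γ : ℝ → V) (s : Set ℝ) : Prop :=
  s.OrdConnected ∧ ContinuousOn γ s ∧
    ∀ t ∈ s, ∀ U ∈ 𝓝 (γ t), ∃ ε > 0, ∀ t₁ ∈ s, ∀ t₂ ∈ s,
      |t₁ - t| < ε → |t₂ - t| < ε → t₁ < t₂ →
        ∃ (c : ℝ → V) (a b : ℝ), g.IsCausalArc c a b ∧ c a = γ t₁ ∧ c b = γ t₂ ∧
          MapsTo c (Icc a b) U

/-- `x` is a past endpoint of the curve `γ` on `s`. -/
def IsPastEndpoint (γ : ℝ → V) (s : Set ℝ) (x : V) : Prop :=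
  ∀ U ∈ 𝓝 x, ∃ t₀ ∈ s, ∀ t ∈ s, t ≤ t₀ → γ t ∈ U

/-- `x` is a future endpoint of the curve `γ` on `s`. -/
def IsFutureEndpoint (γ : ℝ → V) (s : Set ℝ) (x : V) : Prop :=
  ∀ U ∈ 𝓝 x, ∃ t₀ ∈ s, ∀ t ∈ s, t₀ ≤ t → γ t ∈ U

/-! ### Causal relations -/

/-- `p` is joined to `q` by a future-directed timelike curve contained in `U`. -/
def ChronIn (U : Set V) (p q : V) : Prop :=
  ∃ (γ : ℝ → V) (a b : ℝ), g.IsTimelikeCurve γ a b ∧ γ a = p ∧ γ b = q ∧ MapsTo γ (Icc a b) U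

/-- `p` is joined to `q` by a (nondegenerate) continuous future-directed causal curve. -/
def CausallyJoined (p q : V) : Prop :=
  ∃ (γ : ℝ → V) (a b : ℝ), a < b ∧ g.IsCausalCurve γ (Icc a b) ∧ γ a = p ∧ γ b = q

/-- Chronological future `I⁺(p)`. -/
def chronFuture (p : V) : Set V := {q | g.ChronIn univ p q}

/-- Chronological past `I⁻(p)`. -/
def chronPast (p : V) : Set V := {q | g.ChronIn univ q p}

/-- Causal future `J⁺(p)`; it contains `p`. -/
def causalFuture (p : V) : Set V := {q | p = q ∨ g.CausallyJoined p q}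

/-- Causal past `J⁻(p)`; it contains `p`. -/
def causalPast (p : V) : Set V := {q | q = p ∨ g.CausallyJoined q p}

/-- Future Cauchy development `D⁺(A)`: every past-endless causal curve through `x` meets `A`. -/
def futureDevelopment (A : Set V) : Set V :=
  {x | ∀ (γ : ℝ → V) (s : Set ℝ), g.IsCausalCurve γ s → (¬ ∃ y, IsPastEndpoint γ s y) →
    (∃ t ∈ s, γ t = x) → ∃ t ∈ s, γ t ∈ A}

/-- Past Cauchy development `D⁻(A)`: every future-endless causal curve through `x` meets `A`. -/
def pastDevelopment (A : Set V) : Set V :=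
  {x | ∀ (γ : ℝ → V) (s : Set ℝ), g.IsCausalCurve γ s → (¬ ∃ y, IsFutureEndpoint γ s y) →
    (∃ t ∈ s, γ t = x) → ∃ t ∈ s, γ t ∈ A}

/-- Total domain of dependence `D(A) = D⁺(A) ∪ D⁻(A)`. -/
def development (A : Set V) : Set V := g.futureDevelopment A ∪ g.pastDevelopment A

/-- No causal curve goes from a point of `S` to a point of `S` (in particular, no closed causal
curve passes through `S`). -/
def IsAcausal (S : Set V) : Prop := ∀ p ∈ S, ∀ q ∈ S, ¬ g.CausallyJoined p q

/-- The edge of an achronal set `S`: the points `x` of its closure every neighbourhood `U` of which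
contains points `p ∈ I⁻(x, U)` and `q ∈ I⁺(x, U)` joined by a timelike curve in `U` that does not
meet `S`. -/
def edge (S : Set V) : Set V :=
  {x ∈ closure S | ∀ U ∈ 𝓝 x, ∃ p q : V,
    g.ChronIn U p x ∧ g.ChronIn U x q ∧ g.ChronIn (U \ S) p q}

/-- `S` is a (topological, locally flat) hypersurface of the `n`-manifold `V`: near each of its
points some topological chart of `V` straightens `S` to a hyperplane. -/
def IsHypersurface (n : ℕ) {V : Type*} [TopologicalSpace V] (S : Set V) : Prop :=
  ∀ x ∈ S, ∃ (e : OpenPartialHomeomorph V (EuclideanSpace ℝ (Fin n)))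
    (H : Submodule ℝ (EuclideanSpace ℝ (Fin n))),
    x ∈ e.source ∧ Module.finrank ℝ H + 1 = n ∧ e '' (e.source ∩ S) = e.target ∩ H

/-! ### The causality conditions -/

def NotTotallyVicious : Prop := ∀ x : V, g.chronFuture x ∩ g.chronPast x ≠ univ

def Chronological : Prop := ∀ x : V, x ∉ g.chronFuture x

def Causal : Prop := ∀ x : V, g.causalFuture x ∩ g.causalPast x = {x}

def FutureDistinguishing : Prop := ∀ x y : V, g.chronFuture x = g.chronFuture y → x = y

def PastDistinguishing : Prop := ∀ x y : V, g.chronPast x = g.chronPast y → x = y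

def Distinguishing : Prop := g.FutureDistinguishing ∧ g.PastDistinguishing

/-- Every neighbourhood of every point contains a neighbourhood whose intersection with each
future-directed causal curve is empty or connected. -/
def StronglyCausal : Prop :=
  ∀ x : V, ∀ N ∈ 𝓝 x, ∃ U ∈ 𝓝 x, U ⊆ N ∧
    ∀ (γ : ℝ → V) (s : Set ℝ), g.IsCausalCurve γ s →
      γ '' s ∩ U = ∅ ∨ IsConnected (γ '' s ∩ U)

/-- `v` is the gradient of `f` at `x`. -/
def IsGradientAt (f : V → ℝ) (x : V) (v : TangentSpace (𝓡 n) x) : Prop :=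
  ∀ w : TangentSpace (𝓡 n) x, g.metric x v w = mfderiv (𝓡 n) 𝓘(ℝ, ℝ) f x w

/-- There is a smooth function with everywhere timelike gradient. -/
def CausallyStable : Prop :=
  ∃ f : V → ℝ, ContMDiff (𝓡 n) 𝓘(ℝ, ℝ) ∞ f ∧
    ∀ x : V, ∃ v : TangentSpace (𝓡 n) x, g.IsGradientAt f x v ∧ 0 < g.metric x v v

/-- There is an edgeless acausal hypersurface `S` with `D(S) = V`. -/
def GloballyHyperbolic : Prop :=
  ∃ S : Set V, IsHypersurface n S ∧ g.IsAcausal S ∧ g.edge S = ∅ ∧ g.development S = univ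

/-! ### Causal mappings -/

/-- `V ≺ W`: some diffeomorphism `V → W` maps future-directed vectors to future-directed ones. -/
def Precedes {W : Type*} [TopologicalSpace W]
    [ChartedSpace (EuclideanSpace ℝ (Fin n)) W] [IsManifold (𝓡 n) ∞ W]
    (h : Spacetime n W) : Prop :=
  ∃ Φ : V ≃ₘ^∞⟮𝓡 n, 𝓡 n⟯ W, ∀ (x : V) (v : TangentSpace (𝓡 n) x),
    g.IsFuture v → h.IsFuture (x := Φ x) (mfderiv (𝓡 n) (𝓡 n) Φ x v)

end Spacetime

end

/-! A causal map carries causal curves to causal curves by the chain rule. It also carries timelike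
curves to timelike curves: the timelike cone is open and the differential is onto, so a timelike
vector cannot land on the boundary of the target cone (`IsCausalMap.isFutureTimelike`). Since `Φ` is
a homeomorphism, endpoints, closures and connectedness transfer too. So most violations of a
condition in `V` map to violations in `W`, with neighbourhoods and Cauchy hypersurfaces pulled back
by `Φ`.

Two conditions need more. For causal stability, `f ∘ Φ` has a differential that vanishes on no
future-directed vector, and such a covector has a timelike gradient (`lorentz_timelike_of_ne_zero`).
For distinction, `I⁺(Φ x)` may be larger than the image of `I⁺(x)`. But chronological pasts are open
and `x` is a limit of points of `I⁺(x)`, so inclusions between futures in `V` still pass to `W`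
(`chronFuture_subset`). Openness is proved by replacing the end of a timelike arc with a straight
segment in a chart. -/

noncomputable section

/-! ### Lorentzian linear algebra -/

section LorentzForm

variable {E : Type*} [AddCommGroup E] [Module ℝ E] [TopologicalSpace E]
  {B : E →L[ℝ] E →L[ℝ] ℝ}

/-- In Lorentzian signature the orthogonal complement of every timelike vector is negative
definite. -/
theorem lorentz_neg_of_orthogonal (hs : ∀ v w, B v w = B w v)
    (hB : ∃ v, 0 < B v v ∧ ∀ w, B v w = 0 → w ≠ 0 → B w w < 0)
    {e w : E} (he : 0 < B e e) (hw : B e w = 0) (hw0 : w ≠ 0) : B w w < 0 := by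
  obtain ⟨v, hv, hneg⟩ := hB
  by_contra! hq
  have hb : B v e ≠ 0 := by
    intro h0
    have he0 : e ≠ 0 := by
      rintro rfl
      simp at he
    exact absurd (hneg e h0 he0) he.le.not_gt
  have hwe : B w e = 0 := by rw [hs, hw]
  -- If `B w w ≥ 0`, the form is positive semidefinite on the span of `e` and `w`. This combination
  -- lies there and is orthogonal to `v`, hence must vanish.
  have hz1 : B v (B v e • w - B v w • e) = 0 := by
    simp only [map_sub, map_smul, smul_eq_mul]
    ring
  have hz2 : B (B v e • w - B v w • e) (B v e • w - B v w • e)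
      = (B v e) ^ 2 * B w w + (B v w) ^ 2 * B e e := by
    simp only [map_sub, map_smul, smul_eq_mul, sub_apply, smul_apply, hw, hwe]
    ring
  have hb2 : 0 < (B v e) ^ 2 := by positivity
  have hz : B v e • w - B v w • e = 0 := by
    by_contra hne
    have h1 := hneg _ hz1 hne
    rw [hz2] at h1
    have h2 : 0 ≤ (B v e) ^ 2 * B w w + (B v w) ^ 2 * B e e := by positivity
    exact absurd h1 h2.not_gt
  have ha : B v w = 0 := by
    rw [hz] at hz2
    simp only [map_zero] at hz2
    have h1 : 0 ≤ (B v e) ^ 2 * B w w := by positivity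
    have h2 : 0 ≤ (B v w) ^ 2 * B e e := by positivity
    have h3 : (B v w) ^ 2 * B e e = 0 := by linarith
    simpa [he.ne'] using h3
  rw [ha, zero_smul, sub_zero, smul_eq_zero] at hz
  exact hz.elim hb hw0

/-- A Lorentzian form is nondegenerate. -/
theorem lorentz_nondegenerate (hs : ∀ v w, B v w = B w v)
    (hB : ∃ v, 0 < B v v ∧ ∀ w, B v w = 0 → w ≠ 0 → B w w < 0)
    {u : E} (hu : ∀ w, B u w = 0) : u = 0 := by
  obtain ⟨v, hv, hneg⟩ := hB
  by_contra h0
  have := hneg u (by rw [hs, hu]) h0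
  simp [hu] at this

/-- A vector that is orthogonal to no causal vector of the future cone of `e` is timelike. -/
theorem lorentz_timelike_of_ne_zero (hs : ∀ v w, B v w = B w v)
    {e u : E} (he : 0 < B e e) (hu : ∀ w, 0 ≤ B w w → 0 < B e w → B u w ≠ 0) :
    0 < B u u := by
  by_contra! hq
  have hα : B u e ≠ 0 := hu e he.le he
  set α := B u e with hαdef
  -- Up to the factor `B e e`, the component of `u` orthogonal to `e`.
  set s : E := B e e • u - α • e with hsdef
  have hes : B e s = 0 := by
    simp only [hsdef, map_sub, map_smul, smul_eq_mul, hs e u]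
    ring
  have hse : B s e = 0 := by rw [hs, hes]
  have hus : B e e * B u s = B s s := by
    have : B s s = B e e * B u s - α * B e s := by
      calc B s s = B (B e e • u - α • e) s := by rw [← hsdef]
        _ = _ := by simp only [map_sub, map_smul, smul_eq_mul, sub_apply, smul_apply]
    rw [this, hes]; ring
  have hss : B s s = B e e * (B e e * B u u - α ^ 2) := by
    rw [← hus, hsdef]
    simp only [map_sub, map_smul, smul_eq_mul]
    rw [← hαdef]; ring
  have hα2 : 0 < α ^ 2 := by positivity
  have hneg : B s s ≤ - (B e e * α ^ 2) := by
    rw [hss]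
    nlinarith [mul_nonneg (mul_self_nonneg (B e e)) (neg_nonneg.2 hq)]
  have hpos : 0 < - B s s := by nlinarith [mul_pos he hα2]
  -- The combination of `e` and `s` orthogonal to `u`; it is causal exactly because `B u u ≤ 0`.
  refine hu ((- B s s) • e + (B e e * α) • s) ?_ ?_ ?_
  · have : B ((- B s s) • e + (B e e * α) • s) ((- B s s) • e + (B e e * α) • s)
        = (- B s s) * B e e * (- B s s - B e e * α ^ 2) := by
      simp only [map_add, map_smul, smul_eq_mul, add_apply, smul_apply, hes, hse]
      ring
    rw [this]
    have : 0 ≤ - B s s - B e e * α ^ 2 := by linarith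
    positivity
  · simp only [map_add, map_smul, smul_eq_mul, hes]
    nlinarith [mul_pos hpos he]
  · simp only [map_add, map_smul, smul_eq_mul]
    rw [← hαdef]
    linear_combination α * hus

end LorentzForm

namespace Spacetime

/-! ### Hypersurfaces, velocities and endpoints under a diffeomorphism. -/

theorem isHypersurface_preimage {n : ℕ} {V W : Type*} [TopologicalSpace V] [TopologicalSpace W]
    (Φ : V ≃ₜ W) {S : Set W} (hS : IsHypersurface n S) : IsHypersurface n (Φ ⁻¹' S) := by
  intro x hx
  obtain ⟨e, H, hxe, hH, himg⟩ := hS (Φ x) hx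
  refine ⟨Φ.toOpenPartialHomeomorph.trans e, H, by simpa using hxe, hH, ?_⟩
  have hsrc : (Φ.toOpenPartialHomeomorph.trans e).source ∩ Φ ⁻¹' S
      = Φ ⁻¹' (e.source ∩ S) := by simp
  rw [hsrc, OpenPartialHomeomorph.coe_trans, image_comp]
  simpa [image_preimage_eq _ Φ.surjective] using himg

section Diffeomorph

variable {n : ℕ} {V : Type*} [TopologicalSpace V] [ChartedSpace (EuclideanSpace ℝ (Fin n)) V]
  {W : Type*} [TopologicalSpace W] [ChartedSpace (EuclideanSpace ℝ (Fin n)) W]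

theorem velocity_comp (Φ : V ≃ₘ^∞⟮𝓡 n, 𝓡 n⟯ W) {γ : ℝ → V} {a b t : ℝ} (hab : a < b)
    (hγ : ContMDiffOn 𝓘(ℝ, ℝ) (𝓡 n) 1 γ (Icc a b)) (ht : t ∈ Icc a b) :
    velocity n (Φ ∘ γ) a b t = mfderiv (𝓡 n) (𝓡 n) Φ (γ t) (velocity n γ a b t) := by
  unfold velocity
  rw [mfderiv_comp_mfderivWithin t (Φ.mdifferentiable (by simp) (γ t))
    (hγ.mdifferentiableOn (by simp) t ht)
    ((uniqueDiffOn_Icc hab).uniqueMDiffOn t ht)]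
  rfl

theorem isPastEndpoint_of_comp (Φ : V ≃ₘ^∞⟮𝓡 n, 𝓡 n⟯ W) {γ : ℝ → V} {s : Set ℝ} {y : W}
    (hy : IsPastEndpoint (Φ ∘ γ) s y) : IsPastEndpoint γ s (Φ.symm y) := by
  intro U hU
  obtain ⟨t₀, ht₀, H⟩ := hy (Φ.symm ⁻¹' U) (Φ.symm.continuous.continuousAt.preimage_mem_nhds hU)
  exact ⟨t₀, ht₀, fun t ht htt ↦ by simpa using H t ht htt⟩

theorem isFutureEndpoint_of_comp (Φ : V ≃ₘ^∞⟮𝓡 n, 𝓡 n⟯ W) {γ : ℝ → V} {s : Set ℝ} {y : W}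
    (hy : IsFutureEndpoint (Φ ∘ γ) s y) : IsFutureEndpoint γ s (Φ.symm y) := by
  intro U hU
  obtain ⟨t₀, ht₀, H⟩ := hy (Φ.symm ⁻¹' U) (Φ.symm.continuous.continuousAt.preimage_mem_nhds hU)
  exact ⟨t₀, ht₀, fun t ht htt ↦ by simpa using H t ht htt⟩

end Diffeomorph

variable {n : ℕ} {V : Type*} [TopologicalSpace V]
  [ChartedSpace (EuclideanSpace ℝ (Fin n)) V] [IsManifold (𝓡 n) ∞ V] (g : Spacetime n V)
  {W : Type*} [TopologicalSpace W]
  [ChartedSpace (EuclideanSpace ℝ (Fin n)) W] [IsManifold (𝓡 n) ∞ W] (h : Spacetime n W)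

variable {g} in
theorem IsFutureTimelike.isFuture {x : V} {v : TangentSpace (𝓡 n) x}
    (hv : g.IsFutureTimelike v) : g.IsFuture v := ⟨hv.1.le, hv.2⟩

theorem isFutureTimelike_timeField (x : V) : g.IsFutureTimelike (g.timeField x) :=
  ⟨g.timelike_timeField x, g.timelike_timeField x⟩

/-- Every vector is a direction in which a future timelike vector can be perturbed. -/
theorem IsFutureTimelike.exists_add_smul {g : Spacetime n V} {x : V} {v : TangentSpace (𝓡 n) x}
    (hv : g.IsFutureTimelike v) (w : TangentSpace (𝓡 n) x) :
    ∃ ε > 0, ∀ s : ℝ, |s| < ε → g.IsFuture (v + s • w) := by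
  have h1 : Continuous fun s : ℝ ↦ g.metric x v v + s * (2 * g.metric x v w)
    + s * s * g.metric x w w := by fun_prop
  have h2 : Continuous fun s : ℝ ↦ g.metric x (g.timeField x) v
    + s * g.metric x (g.timeField x) w := by fun_prop
  have e1 := h1.continuousAt (x := 0) |>.eventually_const_lt (u := 0) (by simpa using hv.1)
  have e2 := h2.continuousAt (x := 0) |>.eventually_const_lt (u := 0) (by simpa using hv.2)
  obtain ⟨ε, hε, H⟩ := Metric.eventually_nhds_iff.1 (e1.and e2)
  refine ⟨ε, hε, fun s hs ↦ ?_⟩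
  obtain ⟨a, b⟩ := H (y := s) (by simpa using hs)
  refine ⟨?_, ?_⟩
  · have : g.metric x (v + s • w) (v + s • w) = g.metric x v v + s * (2 * g.metric x v w)
        + s * s * g.metric x w w := by
      simp only [map_add, map_smul, smul_eq_mul, add_apply, smul_apply, g.symm x w v]
      ring
    rw [this]; exact a.le
  · simpa using b

/-- `Φ` maps future-directed vectors to future-directed vectors. -/
def IsCausalMap (Φ : V ≃ₘ^∞⟮𝓡 n, 𝓡 n⟯ W) : Prop :=
  ∀ (x : V) (v : TangentSpace (𝓡 n) x),
    g.IsFuture v → h.IsFuture (x := Φ x) (mfderiv (𝓡 n) (𝓡 n) Φ x v)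

/-! ### Vectors, curves and causal relations under a causal map. -/

namespace IsCausalMap

variable {g h} {Φ : V ≃ₘ^∞⟮𝓡 n, 𝓡 n⟯ W}

/-- A causal map preserves timelike vectors. -/
theorem isFutureTimelike (hΦ : g.IsCausalMap h Φ) {x : V} {v : TangentSpace (𝓡 n) x}
    (hv : g.IsFutureTimelike v) :
    h.IsFutureTimelike (x := Φ x) (mfderiv (𝓡 n) (𝓡 n) Φ x v) := by
  obtain ⟨h0, hξ⟩ := hΦ x v hv.isFuture
  refine ⟨lt_of_le_of_ne h0 fun hzero ↦ hξ.ne' ?_, hξ⟩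
  have hbij : Function.Surjective (mfderiv (𝓡 n) (𝓡 n) Φ x) :=
    (Φ.mfderivToContinuousLinearEquiv (by simp) x).surjective
  -- If the image of `v` were null, moving `v` by `-s • w` would give its image the square `-2 * s *
  -- p + s * s * q`, negative for small `s > 0`, although `v - s • w` is still future-directed.
  obtain ⟨w, hw⟩ := hbij (h.timeField (Φ x))
  obtain ⟨ε, hε, H⟩ := hv.exists_add_smul w
  set q := h.metric (Φ x) (h.timeField (Φ x)) (h.timeField (Φ x)) with hq
  set p := h.metric (Φ x) (h.timeField (Φ x)) (mfderiv (𝓡 n) (𝓡 n) Φ x v) with hp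
  have hqpos : 0 < q := h.timelike_timeField (Φ x)
  have key : ∀ s : ℝ, |s| < ε → 0 ≤ s * (2 * p) + s * s * q := by
    intro s hs
    have h1 := (hΦ x _ (H s hs)).1
    rw [map_add, map_smul, hw] at h1
    simp only [map_add, map_smul, smul_eq_mul, add_apply, smul_apply] at h1
    rw [← hzero, h.symm (Φ x) _ (h.timeField (Φ x)), ← hp, ← hq] at h1
    linarith
  obtain ⟨s, hs0, hs1, hs2⟩ : ∃ s : ℝ, 0 < s ∧ s < ε ∧ s * q < p := by
    refine ⟨min (ε / 2) (p / (2 * q)), by positivity, ?_, ?_⟩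
    · exact (min_le_left _ _).trans_lt (by linarith)
    · calc _ ≤ p / (2 * q) * q := by gcongr; exact min_le_right _ _
        _ = p / 2 := by field_simp
        _ < p := by linarith
  have := key (-s) (by rw [abs_neg, abs_of_pos hs0]; exact hs1)
  nlinarith

theorem isCausalArc (hΦ : g.IsCausalMap h Φ) {γ : ℝ → V} {a b : ℝ} (hγ : g.IsCausalArc γ a b) :
    h.IsCausalArc (Φ ∘ γ) a b := by
  obtain ⟨hab, hc, hv⟩ := hγ
  refine ⟨hab, (Φ.contMDiff.of_le (by simp)).comp_contMDiffOn hc, fun t ht ↦ ?_⟩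
  rw [velocity_comp Φ hab hc ht]
  exact hΦ _ _ (hv t ht)

theorem isTimelikeArc (hΦ : g.IsCausalMap h Φ) {γ : ℝ → V} {a b : ℝ}
    (hγ : g.IsTimelikeArc γ a b) : h.IsTimelikeArc (Φ ∘ γ) a b := by
  obtain ⟨hab, hc, hv⟩ := hγ
  refine ⟨hab, (Φ.contMDiff.of_le (by simp)).comp_contMDiffOn hc, fun t ht ↦ ?_⟩
  rw [velocity_comp Φ hab hc ht]
  exact hΦ.isFutureTimelike (hv t ht)

theorem chronIn (hΦ : g.IsCausalMap h Φ) {U : Set V} {U' : Set W} (hU : MapsTo Φ U U') {p q : V}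
    (hpq : g.ChronIn U p q) : h.ChronIn U' (Φ p) (Φ q) := by
  obtain ⟨γ, a, b, ⟨hab, k, τ, h0, hk, hτ⟩, rfl, rfl, hm⟩ := hpq
  exact ⟨Φ ∘ γ, a, b, ⟨hab, k, τ, h0, hk, fun i hi ↦ hΦ.isTimelikeArc (hτ i hi)⟩, rfl, rfl,
    hU.comp hm⟩

theorem chronIn_univ (hΦ : g.IsCausalMap h Φ) {p q : V} (hpq : g.ChronIn univ p q) :
    h.ChronIn univ (Φ p) (Φ q) :=
  hΦ.chronIn (mapsTo_univ _ _) hpq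

theorem isCausalCurve (hΦ : g.IsCausalMap h Φ) {γ : ℝ → V} {s : Set ℝ}
    (hγ : g.IsCausalCurve γ s) : h.IsCausalCurve (Φ ∘ γ) s := by
  obtain ⟨hs, hc, hl⟩ := hγ
  refine ⟨hs, Φ.continuous.comp_continuousOn hc, fun t ht U hU ↦ ?_⟩
  obtain ⟨ε, hε, H⟩ := hl t ht (Φ ⁻¹' U) (Φ.continuous.continuousAt.preimage_mem_nhds hU)
  refine ⟨ε, hε, fun t₁ ht₁ t₂ ht₂ h1 h2 h12 ↦ ?_⟩
  obtain ⟨c, a, b, hcab, ha, hb, hm⟩ := H t₁ ht₁ t₂ ht₂ h1 h2 h12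
  exact ⟨Φ ∘ c, a, b, hΦ.isCausalArc hcab, congrArg Φ ha, congrArg Φ hb, hm⟩

theorem causallyJoined (hΦ : g.IsCausalMap h Φ) {p q : V} (hpq : g.CausallyJoined p q) :
    h.CausallyJoined (Φ p) (Φ q) := by
  obtain ⟨γ, a, b, hab, hγ, rfl, rfl⟩ := hpq
  exact ⟨Φ ∘ γ, a, b, hab, hΦ.isCausalCurve hγ, rfl, rfl⟩

/-! ### Conditions that pull back directly -/

theorem notTotallyVicious (hΦ : g.IsCausalMap h Φ) (hh : h.NotTotallyVicious) :
    g.NotTotallyVicious := by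
  intro x hx
  refine hh (Φ x) (eq_univ_of_forall fun y ↦ ?_)
  obtain ⟨z, rfl⟩ := Φ.surjective y
  obtain ⟨h1, h2⟩ : z ∈ g.chronFuture x ∩ g.chronPast x := hx ▸ mem_univ z
  exact ⟨hΦ.chronIn_univ h1, hΦ.chronIn_univ h2⟩

theorem chronological (hΦ : g.IsCausalMap h Φ) (hh : h.Chronological) : g.Chronological :=
  fun x hx ↦ hh (Φ x) (hΦ.chronIn_univ hx)

theorem causal (hΦ : g.IsCausalMap h Φ) (hh : h.Causal) : g.Causal := by
  intro x
  refine Subset.antisymm ?_ (singleton_subset_iff.2 ⟨Or.inl rfl, Or.inl rfl⟩)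
  rintro y ⟨hy1, hy2⟩
  have : Φ y ∈ h.causalFuture (Φ x) ∩ h.causalPast (Φ x) :=
    ⟨hy1.imp (congrArg Φ) hΦ.causallyJoined, hy2.imp (congrArg Φ) hΦ.causallyJoined⟩
  rw [hh (Φ x)] at this
  exact Φ.injective this

theorem stronglyCausal (hΦ : g.IsCausalMap h Φ) (hh : h.StronglyCausal) : g.StronglyCausal := by
  intro x N hN
  obtain ⟨U, hU, hUN, H⟩ := hh (Φ x) (Φ.symm ⁻¹' N)
    (Φ.symm.continuous.continuousAt.preimage_mem_nhds (by simpa using hN))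
  refine ⟨Φ ⁻¹' U, Φ.continuous.continuousAt.preimage_mem_nhds hU,
    fun y hy ↦ by simpa using hUN hy, fun γ s hγ ↦ ?_⟩
  have himg : γ '' s ∩ Φ ⁻¹' U = Φ.symm '' ((Φ ∘ γ) '' s ∩ U) := by
    ext y
    constructor
    · rintro ⟨⟨t, ht, rfl⟩, hy⟩
      exact ⟨Φ (γ t), ⟨⟨t, ht, rfl⟩, hy⟩, by simp⟩
    · rintro ⟨_, ⟨⟨t, ht, rfl⟩, hy⟩, rfl⟩
      exact ⟨⟨t, ht, by simp⟩, by simpa using hy⟩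
  rw [himg]
  refine (H _ s (hΦ.isCausalCurve hγ)).imp (fun h0 ↦ by rw [h0, image_empty]) fun hc ↦ ?_
  exact hc.image _ Φ.symm.continuous.continuousOn

/-- The witness is `f ∘ Φ`. A timelike gradient of `f` is orthogonal to no nonzero causal vector, so
the differential of `f ∘ Φ` vanishes on no future-directed vector of `V`, which forces its own
gradient to be timelike. -/
theorem causallyStable (hΦ : g.IsCausalMap h Φ) (hh : h.CausallyStable) : g.CausallyStable := by
  obtain ⟨f, hf, H⟩ := hh
  refine ⟨f ∘ Φ, hf.comp Φ.contMDiff, fun x ↦ ?_⟩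
  obtain ⟨v, hv, hvv⟩ := H (Φ x)
  have : FiniteDimensional ℝ (TangentSpace (𝓡 n) x) :=
    inferInstanceAs (FiniteDimensional ℝ (EuclideanSpace ℝ (Fin n)))
  -- Lowering an index: injective by nondegeneracy, hence onto by dimension, so the gradient exists.
  let L : TangentSpace (𝓡 n) x →ₗ[ℝ] Module.Dual ℝ (TangentSpace (𝓡 n) x) :=
    ContinuousLinearMap.coeLM ℝ ∘ₗ (g.metric x).toLinearMap
  have hinj : Function.Injective L := by
    rw [← LinearMap.ker_eq_bot, LinearMap.ker_eq_bot']
    intro u hu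
    exact lorentz_nondegenerate (g.symm x) (g.lorentzian x) fun w ↦ LinearMap.congr_fun hu w
  obtain ⟨u, hu⟩ := (LinearMap.injective_iff_surjective_of_finrank_eq_finrank
    (Subspace.dual_finrank_eq (K := ℝ) (V := TangentSpace (𝓡 n) x)).symm).1 hinj
    (mfderiv (𝓡 n) 𝓘(ℝ, ℝ) (f ∘ Φ) x).toLinearMap
  have hgrad : g.IsGradientAt (f ∘ Φ) x u := fun w ↦ LinearMap.congr_fun hu w
  refine ⟨u, hgrad, lorentz_timelike_of_ne_zero (g.symm x) (g.timelike_timeField x) ?_⟩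
  intro w hw hξw h0
  have hfut := hΦ x w ⟨hw, hξw⟩
  rw [hgrad w, mfderiv_comp x (hf.mdifferentiableAt (by simp))
    (Φ.mdifferentiable (by simp) x)] at h0
  have h1 : h.metric (Φ x) v (mfderiv (𝓡 n) (𝓡 n) Φ x w) = 0 := (hv _).trans h0
  refine absurd (lorentz_neg_of_orthogonal (h.symm (Φ x)) (h.lorentzian (Φ x)) hvv h1 ?_)
    hfut.1.not_gt
  intro hz
  have := hfut.2
  rw [hz, map_zero] at this
  exact this.false

/-- The Cauchy hypersurface is `Φ ⁻¹' S`. An endpoint of `Φ ∘ γ` would pull back to one of `γ`, so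
images of endless curves are endless and must meet `S`. -/
theorem globallyHyperbolic (hΦ : g.IsCausalMap h Φ) (hh : h.GloballyHyperbolic) :
    g.GloballyHyperbolic := by
  obtain ⟨S, hS, hac, hedge, hD⟩ := hh
  refine ⟨Φ ⁻¹' S, isHypersurface_preimage Φ.toHomeomorph hS,
    fun p hp q hq hpq ↦ hac _ hp _ hq (hΦ.causallyJoined hpq), ?_, ?_⟩
  · refine eq_empty_of_forall_notMem fun x hx ↦ ?_
    have : Φ x ∈ h.edge S := by
      refine ⟨Φ.continuous.closure_preimage_subset S hx.1, fun U hU ↦ ?_⟩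
      obtain ⟨p, q, h1, h2, h3⟩ := hx.2 (Φ ⁻¹' U)
        (Φ.continuous.continuousAt.preimage_mem_nhds hU)
      exact ⟨Φ p, Φ q, hΦ.chronIn (mapsTo_preimage _ _) h1,
        hΦ.chronIn (mapsTo_preimage _ _) h2, hΦ.chronIn (mapsTo_preimage Φ (U \ S)) h3⟩
    rw [hedge] at this
    exact this
  · refine eq_univ_of_forall fun x ↦ ?_
    have hx : Φ x ∈ h.development S := hD ▸ mem_univ _
    refine hx.imp (fun H γ s hγ he hxs ↦ ?_) (fun H γ s hγ he hxs ↦ ?_)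
    · obtain ⟨t, ht, rfl⟩ := hxs
      exact H (Φ ∘ γ) s (hΦ.isCausalCurve hγ)
        (fun ⟨y, hy⟩ ↦ he ⟨_, isPastEndpoint_of_comp Φ hy⟩) ⟨t, ht, rfl⟩
    · obtain ⟨t, ht, rfl⟩ := hxs
      exact H (Φ ∘ γ) s (hΦ.isCausalCurve hγ)
        (fun ⟨y, hy⟩ ↦ he ⟨_, isFutureEndpoint_of_comp Φ hy⟩) ⟨t, ht, rfl⟩

end IsCausalMap

/-! ### Timelike arcs -/

section Arcs

variable {g}

/-- The vectors lie in different fibres, so they are compared in the model space to which every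
fibre unfolds. -/
theorem IsFutureTimelike.congr {x y : V} (hxy : x = y) {v : TangentSpace (𝓡 n) x}
    {w : TangentSpace (𝓡 n) y}
    (hvw : (show EuclideanSpace ℝ (Fin n) from v) = (show EuclideanSpace ℝ (Fin n) from w))
    (hv : g.IsFutureTimelike v) : g.IsFutureTimelike w := by
  subst hxy
  have : v = w := hvw
  exact this ▸ hv

theorem IsTimelikeArc.congr {γ γ' : ℝ → V} {a b : ℝ} (hγ : g.IsTimelikeArc γ a b)
    (heq : EqOn γ' γ (Icc a b)) : g.IsTimelikeArc γ' a b := by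
  obtain ⟨hab, hc, hv⟩ := hγ
  refine ⟨hab, hc.congr heq, fun t ht ↦ (hv t ht).congr (heq ht).symm ?_⟩
  exact congrArg (fun L : ℝ →L[ℝ] EuclideanSpace ℝ (Fin n) ↦ L 1)
    (mfderivWithin_congr (I := 𝓘(ℝ, ℝ)) (I' := 𝓡 n) heq (heq ht)).symm

theorem IsTimelikeArc.mono {γ : ℝ → V} {a b c d : ℝ} (hγ : g.IsTimelikeArc γ a b)
    (hac : a ≤ c) (hcd : c < d) (hdb : d ≤ b) : g.IsTimelikeArc γ c d := by
  obtain ⟨hab, hc, hv⟩ := hγ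
  have hsub : Icc c d ⊆ Icc a b := Icc_subset_Icc hac hdb
  refine ⟨hcd, hc.mono hsub, fun t ht ↦ ?_⟩
  have : velocity n γ c d t = velocity n γ a b t := by
    unfold velocity
    rw [mfderivWithin_subset hsub ((uniqueDiffOn_Icc hcd).uniqueMDiffOn t ht)
      (hc.mdifferentiableOn (by simp) t (hsub ht))]
  rw [this]
  exact hv t (hsub ht)

theorem IsTimelikeArc.comp_add_const {γ : ℝ → V} {a b : ℝ} (hγ : g.IsTimelikeArc γ a b) (s : ℝ) :
    g.IsTimelikeArc (fun t ↦ γ (t + s)) (a - s) (b - s) := by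
  obtain ⟨hab, hc, hv⟩ := hγ
  have hmaps : MapsTo (fun t : ℝ ↦ t + s) (Icc (a - s) (b - s)) (Icc a b) :=
    fun t ht ↦ ⟨by linarith [ht.1], by linarith [ht.2]⟩
  have hshift : ContMDiff 𝓘(ℝ, ℝ) 𝓘(ℝ, ℝ) 1 (fun t : ℝ ↦ t + s) :=
    (contDiff_id.add contDiff_const).contMDiff
  have hlt : a - s < b - s := by linarith
  refine ⟨hlt, hc.comp hshift.contMDiffOn hmaps, fun t ht ↦ ?_⟩
  have hu := (uniqueDiffOn_Icc hlt).uniqueMDiffOn t ht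
  have : velocity n (fun t ↦ γ (t + s)) (a - s) (b - s) t = velocity n γ a b (t + s) := by
    unfold velocity
    have hcomp := mfderivWithin_comp (I := 𝓘(ℝ, ℝ)) (I' := 𝓘(ℝ, ℝ)) (I'' := 𝓡 n)
      (f := fun t : ℝ ↦ t + s) (g := γ) t
      (hc.mdifferentiableOn (by simp) (t + s) (hmaps ht))
      (hshift.mdifferentiableAt (by simp)).mdifferentiableWithinAt hmaps hu
    have hone : mfderivWithin 𝓘(ℝ, ℝ) 𝓘(ℝ, ℝ) (fun t : ℝ ↦ t + s) (Icc (a - s) (b - s)) t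
        (1 : ℝ) = (1 : ℝ) := by
      rw [mfderivWithin_eq_fderivWithin]
      have hd : HasDerivAt (fun t : ℝ ↦ t + s) 1 t := (hasDerivAt_id t).add_const s
      exact hd.hasDerivWithinAt.derivWithin (uniqueDiffOn_Icc hlt t ht)
    calc _ = mfderivWithin 𝓘(ℝ, ℝ) (𝓡 n) γ (Icc a b) (t + s)
          (mfderivWithin 𝓘(ℝ, ℝ) 𝓘(ℝ, ℝ) (fun t : ℝ ↦ t + s) (Icc (a - s) (b - s)) t (1 : ℝ)) :=
          congrArg (fun L : ℝ →L[ℝ] EuclideanSpace ℝ (Fin n) ↦ L 1) hcomp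
      _ = _ := by rw [hone]
  rw [this]
  exact hv _ (hmaps ht)

variable (g) in
/-- `p` is joined to `q` by a single timelike arc. -/
def ArcJoined (p q : V) : Prop :=
  ∃ (γ : ℝ → V) (a b : ℝ), g.IsTimelikeArc γ a b ∧ γ a = p ∧ γ b = q

theorem ChronIn.transGen {U : Set V} {p q : V} (hpq : g.ChronIn U p q) :
    Relation.TransGen g.ArcJoined p q := by
  obtain ⟨γ, a, b, ⟨hab, k, τ, rfl, rfl, hτ⟩, rfl, rfl, -⟩ := hpq
  have key : ∀ i, i + 1 ≤ k → Relation.TransGen g.ArcJoined (γ (τ 0)) (γ (τ (i + 1))) := by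
    intro i
    induction i with
    | zero => exact fun hk ↦ .single ⟨γ, _, _, hτ 0 hk, rfl, rfl⟩
    | succ i ih => exact fun hk ↦ (ih (by omega)).tail ⟨γ, _, _, hτ (i + 1) hk, rfl, rfl⟩
  cases k with
  | zero => exact absurd hab (lt_irrefl _)
  | succ k => exact key k le_rfl

theorem ChronIn.tail_arc {p q r : V} (hpq : g.ChronIn univ p q) (hqr : g.ArcJoined q r) :
    g.ChronIn univ p r := by
  obtain ⟨γ, a, b, ⟨hab, k, τ, h0, hk, hτ⟩, rfl, rfl, -⟩ := hpq
  obtain ⟨c, a', b', hc, hca, rfl⟩ := hqr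
  have hab' : a' < b' := hc.1
  have hτb : ∀ i, i ≤ k → τ i ≤ b := by
    intro i hi
    induction hi using Nat.decreasingInduction with
    | self => exact hk.le
    | of_succ i hi ih => exact (hτ i hi).1.le.trans ih
  -- The arc `c` is translated to start at parameter `b`. At the junction the first branch applies,
  -- and `hca` makes the two agree there.
  refine ⟨fun t ↦ if t ≤ b then γ t else c (t + (a' - b)), a, b + (b' - a'),
    ⟨by linarith, k + 1, fun i ↦ if i ≤ k then τ i else b + (b' - a'), by simpa using h0, by simp,
      fun i hi ↦ ?_⟩, by simp [hab.le], ?_, mapsTo_univ _ _⟩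
  · rcases Nat.lt_succ_iff_lt_or_eq.1 hi with hik | rfl
    · have h1 : i + 1 ≤ k := hik
      simp only [hik.le, h1, if_true]
      exact (hτ i hik).congr fun t ht ↦ if_pos (ht.2.trans (hτb _ h1))
    · have h1 : ¬ i + 1 ≤ i := by omega
      simp only [le_refl, if_true, h1, if_false, hk]
      have hs := hc.comp_add_const (a' - b)
      have e1 : a' - (a' - b) = b := by ring
      have e2 : b' - (a' - b) = b + (b' - a') := by ring
      rw [e1, e2] at hs
      refine hs.congr fun t ht ↦ ?_
      rcases ht.1.eq_or_lt with rfl | hlt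
      · simp [hca]
      · simp [hlt.not_ge]
  · have : ¬ b + (b' - a') ≤ b := by linarith
    simp only [this, if_false]
    congr 1
    ring

/-- Chains of arcs make transitivity formal and allow the first or last arc to be modified alone. -/
theorem chronIn_univ_iff_transGen {p q : V} :
    g.ChronIn univ p q ↔ Relation.TransGen g.ArcJoined p q := by
  refine ⟨ChronIn.transGen, fun H ↦ ?_⟩
  induction H with
  | single hpq =>
    obtain ⟨γ, a, b, hγ, rfl, rfl⟩ := hpq
    refine ⟨γ, a, b, ⟨hγ.1, 1, fun i ↦ if i = 0 then a else b, by simp, by simp, fun i hi ↦ ?_⟩,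
      rfl, rfl, mapsTo_univ _ _⟩
    obtain rfl : i = 0 := by omega
    simpa using hγ
  | tail _ hqr ih => exact ih.tail_arc hqr

end Arcs

/-! ### Openness of the timelike cones and of chronological futures and pasts -/

theorem isOpen_setOf_isFutureTimelike :
    IsOpen {p : TangentBundle (𝓡 n) V | g.IsFutureTimelike p.2} := by
  have hm : Continuous fun p : TangentBundle (𝓡 n) V ↦
      TotalSpace.mk' (EuclideanSpace ℝ (Fin n) →L[ℝ] EuclideanSpace ℝ (Fin n) →L[ℝ] ℝ)
        (E := fun y : V ↦ TangentSpace (𝓡 n) y →L[ℝ] TangentSpace (𝓡 n) y →L[ℝ] ℝ)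
        p.1 (g.metric p.1) :=
    g.contMDiff_metric.continuous.comp (FiberBundle.continuous_proj _ _)
  have hid : Continuous fun p : TangentBundle (𝓡 n) V ↦
      TotalSpace.mk' (EuclideanSpace ℝ (Fin n)) (E := fun y : V ↦ TangentSpace (𝓡 n) y) p.1 p.2 :=
    continuous_id
  have hξ : Continuous fun p : TangentBundle (𝓡 n) V ↦
      TotalSpace.mk' (EuclideanSpace ℝ (Fin n)) (E := fun y : V ↦ TangentSpace (𝓡 n) y)
        p.1 (g.timeField p.1) :=
    g.continuous_timeField.comp (FiberBundle.continuous_proj _ _)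
  have h1 : Continuous fun p : TangentBundle (𝓡 n) V ↦ g.metric p.1 p.2 p.2 := by
    have := Continuous.clm_bundle_apply₂ (F₃ := ℝ) (E₃ := Bundle.Trivial V ℝ) hm hid hid
    exact continuous_snd.comp ((Bundle.Trivial.homeomorphProd V ℝ).continuous.comp this)
  have h2 : Continuous fun p : TangentBundle (𝓡 n) V ↦ g.metric p.1 (g.timeField p.1) p.2 := by
    have := Continuous.clm_bundle_apply₂ (F₃ := ℝ) (E₃ := Bundle.Trivial V ℝ) hm hξ hid
    exact continuous_snd.comp ((Bundle.Trivial.homeomorphProd V ℝ).continuous.comp this)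
  exact (isOpen_lt continuous_const h1).inter (isOpen_lt continuous_const h2)

/-- The differential of the inverse of the preferred chart at `x`. -/
def chartSymmDeriv (x : V) (z : EuclideanSpace ℝ (Fin n)) :
    EuclideanSpace ℝ (Fin n) →L[ℝ] TangentSpace (𝓡 n) ((extChartAt (𝓡 n) x).symm z) :=
  mfderivWithin 𝓘(ℝ, EuclideanSpace ℝ (Fin n)) (𝓡 n) (extChartAt (𝓡 n) x).symm
    (extChartAt (𝓡 n) x).target z

variable {g} in
/-- In a chart, nearly parallel displacements near a timelike vector are timelike arcs. -/
theorem exists_ball_arcJoined {x : V} {z₀ w₀ : EuclideanSpace ℝ (Fin n)}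
    (hz₀ : z₀ ∈ (extChartAt (𝓡 n) x).target)
    (hw₀ : g.IsFutureTimelike (chartSymmDeriv x z₀ w₀)) :
    ∃ r > 0, ∀ z w, ∀ δ : ℝ, 0 < δ → dist z z₀ < r → dist (z + δ • w) z₀ < r → dist w w₀ < r →
      g.ArcJoined ((extChartAt (𝓡 n) x).symm z) ((extChartAt (𝓡 n) x).symm (z + δ • w)) := by
  set φ := extChartAt (𝓡 n) x with hφ
  have hopen : IsOpen φ.target := isOpen_extChartAt_target x
  have hsm : ContMDiffOn 𝓘(ℝ, EuclideanSpace ℝ (Fin n)) (𝓡 n) 1 φ.symm φ.target :=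
    (contMDiffOn_extChartAt_symm (n := ∞) x).of_le (by simp)
  have hcont := hsm.continuousOn_tangentMapWithin le_rfl hopen.uniqueMDiffOn
  let F : EuclideanSpace ℝ (Fin n) × EuclideanSpace ℝ (Fin n) →
      TangentBundle 𝓘(ℝ, EuclideanSpace ℝ (Fin n)) (EuclideanSpace ℝ (Fin n)) :=
    (tangentBundleModelSpaceHomeomorph 𝓘(ℝ, EuclideanSpace ℝ (Fin n))).symm
  have hF : Continuous F :=
    (tangentBundleModelSpaceHomeomorph 𝓘(ℝ, EuclideanSpace ℝ (Fin n))).symm.continuous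
  -- The tangent map of the inverse chart is continuous, so openness of the timelike cones pulls
  -- back to pairs (point, direction).
  have hev : ∀ᶠ p in 𝓝 (z₀, w₀), p.1 ∈ φ.target ∧
      g.IsFutureTimelike (chartSymmDeriv x p.1 p.2) := by
    have hmem : (F (z₀, w₀)) ∈ (π (EuclideanSpace ℝ (Fin n))
      (TangentSpace 𝓘(ℝ, EuclideanSpace ℝ (Fin n)))) ⁻¹' φ.target := hz₀
    have hca := (hcont _ hmem).continuousAt
      ((hopen.preimage (FiberBundle.continuous_proj _ _)).mem_nhds hmem)
    have hca2 := ContinuousAt.comp (f := F) (x := (z₀, w₀)) hca hF.continuousAt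
    exact ((continuous_fst.tendsto (z₀, w₀)).eventually (hopen.mem_nhds hz₀)).and
      (hca2.eventually (g.isOpen_setOf_isFutureTimelike.mem_nhds hw₀))
  obtain ⟨r, hr, H⟩ := Metric.eventually_nhds_iff.1 hev
  refine ⟨r, hr, fun z w δ hδ hz hzw hw ↦ ?_⟩
  -- Balls are convex: once both ends are in the ball the whole segment is, whatever the size of
  -- `δ`.
  have hseg : ∀ t ∈ Icc 0 δ, z + t • w ∈ φ.target ∧
      g.IsFutureTimelike (chartSymmDeriv x (z + t • w) w) := by
    intro t ht
    refine H (y := (z + t • w, w)) (max_lt ?_ hw)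
    have := (convex_ball z₀ r).add_smul_sub_mem (x := z) (y := z + δ • w) hz hzw
      (t := t / δ) ⟨div_nonneg ht.1 hδ.le, (div_le_one hδ).2 ht.2⟩
    rw [add_sub_cancel_left, smul_smul, div_mul_cancel₀ _ hδ.ne'] at this
    exact this
  have hline : ContDiff ℝ 1 (fun t : ℝ ↦ z + t • w) := by fun_prop
  refine ⟨fun t ↦ φ.symm (z + t • w), 0, δ, ⟨hδ, ?_, fun t ht ↦ ?_⟩, by simp, rfl⟩
  · exact hsm.comp hline.contMDiff.contMDiffOn fun t ht ↦ (hseg t ht).1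
  · have hu := (uniqueDiffOn_Icc hδ).uniqueMDiffOn t ht
    have hcomp := mfderivWithin_comp (I := 𝓘(ℝ, ℝ)) (I' := 𝓘(ℝ, EuclideanSpace ℝ (Fin n)))
      (I'' := 𝓡 n) (f := fun t : ℝ ↦ z + t • w) (g := φ.symm) (s := Icc 0 δ) (u := φ.target) t
      (hsm.mdifferentiableOn (by simp) _ (hseg t ht).1)
      (hline.contMDiff.mdifferentiableAt (by simp)).mdifferentiableWithinAt
      (fun t ht ↦ (hseg t ht).1) hu
    have hone : mfderivWithin 𝓘(ℝ, ℝ) 𝓘(ℝ, EuclideanSpace ℝ (Fin n)) (fun t : ℝ ↦ z + t • w)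
        (Icc 0 δ) t (1 : ℝ) = w := by
      rw [mfderivWithin_eq_fderivWithin]
      have hd : HasDerivAt (fun t : ℝ ↦ z + t • w) ((1 : ℝ) • w) t :=
        ((hasDerivAt_id t).smul_const w).const_add z
      rw [one_smul] at hd
      exact hd.hasDerivWithinAt.derivWithin (uniqueDiffOn_Icc hδ t ht)
    have : velocity n (fun t ↦ φ.symm (z + t • w)) 0 δ t = chartSymmDeriv x (z + t • w) w := by
      calc _ = mfderivWithin 𝓘(ℝ, EuclideanSpace ℝ (Fin n)) (𝓡 n) φ.symm φ.target (z + t • w)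
            (mfderivWithin 𝓘(ℝ, ℝ) 𝓘(ℝ, EuclideanSpace ℝ (Fin n)) (fun t : ℝ ↦ z + t • w)
              (Icc 0 δ) t (1 : ℝ)) :=
            congrArg (fun L : ℝ →L[ℝ] EuclideanSpace ℝ (Fin n) ↦ L 1) hcomp
        _ = _ := by rw [hone]; rfl
    rw [this]
    exact (hseg t ht).2

theorem chartSymmDeriv_surjective (x : V) {z : EuclideanSpace ℝ (Fin n)}
    (hz : z ∈ (extChartAt (𝓡 n) x).target) : Function.Surjective (chartSymmDeriv x z) := by
  have h1 : MDifferentiableWithinAt 𝓘(ℝ, EuclideanSpace ℝ (Fin n)) (𝓡 n)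
      (extChartAt (𝓡 n) x).symm (range (𝓡 n)) z := mdifferentiableWithinAt_extChartAt_symm hz
  have h2 : chartSymmDeriv x z = mfderivWithin 𝓘(ℝ, EuclideanSpace ℝ (Fin n)) (𝓡 n)
      (extChartAt (𝓡 n) x).symm (range (𝓡 n)) z :=
    mfderivWithin_subset (extChartAt_target_subset_range x)
      ((isOpen_extChartAt_target x).uniqueMDiffOn z hz) h1
  rw [h2]
  exact (isInvertible_mfderivWithin_extChartAt_symm hz).bijective.surjective

variable {g}

/-- The chart expression of a timelike arc has a timelike derivative. -/
theorem IsTimelikeArc.exists_hasDerivWithinAt {γ : ℝ → V} {a b t : ℝ}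
    (hγ : g.IsTimelikeArc γ a b) (ht : t ∈ Icc a b) :
    ∃ w, HasDerivWithinAt (extChartAt (𝓡 n) (γ t) ∘ γ) w (Icc a b) t ∧
      g.IsFutureTimelike (chartSymmDeriv (γ t) (extChartAt (𝓡 n) (γ t) (γ t)) w) := by
  obtain ⟨hab, hc, hv⟩ := hγ
  set φ := extChartAt (𝓡 n) (γ t) with hφ
  have hsrc : γ t ∈ φ.source := mem_extChartAt_source (γ t)
  have hz : φ (γ t) ∈ φ.target := φ.map_source hsrc
  have hud := uniqueDiffOn_Icc hab t ht
  have hγd : MDifferentiableWithinAt 𝓘(ℝ, ℝ) (𝓡 n) γ (Icc a b) t :=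
    hc.mdifferentiableOn (by simp) t ht
  have hfd : MDifferentiableWithinAt 𝓘(ℝ, ℝ) 𝓘(ℝ, EuclideanSpace ℝ (Fin n)) (φ ∘ γ) (Icc a b) t :=
    (mdifferentiableAt_extChartAt (mem_chart_source _ (γ t))).comp_mdifferentiableWithinAt t hγd
  have hw : HasDerivWithinAt (φ ∘ γ) (derivWithin (φ ∘ γ) (Icc a b) t) (Icc a b) t :=
    hfd.differentiableWithinAt.hasDerivWithinAt
  refine ⟨_, hw, (hv t ht).congr (φ.left_inv hsrc).symm ?_⟩
  have hsymm : MDifferentiableWithinAt 𝓘(ℝ, EuclideanSpace ℝ (Fin n)) (𝓡 n) φ.symm φ.target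
      (φ (γ t)) := mdifferentiableOn_extChartAt_symm _ hz
  -- Only the germ at `t` stays in the chart, so the chain rule is applied to this local
  -- factorization.
  have hnear : γ =ᶠ[𝓝[Icc a b] t] φ.symm ∘ (φ ∘ γ) := by
    filter_upwards [hγd.continuousWithinAt (extChartAt_source_mem_nhds (I := 𝓡 n) (γ t))]
      with s hs
    exact (φ.left_inv hs).symm
  have h1 := hnear.mfderivWithin_eq (I := 𝓘(ℝ, ℝ)) (I' := 𝓡 n) (φ.left_inv hsrc).symm
  have h2 := mfderivWithin_comp_of_preimage_mem_nhdsWithin (I := 𝓘(ℝ, ℝ))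
    (I' := 𝓘(ℝ, EuclideanSpace ℝ (Fin n))) (I'' := 𝓡 n) (f := φ ∘ γ) (g := φ.symm) (s := Icc a b)
    (u := φ.target) t hsymm hfd
    (hfd.continuousWithinAt ((isOpen_extChartAt_target (γ t)).mem_nhds hz))
    hud.uniqueMDiffWithinAt
  rw [mfderivWithin_eq_fderivWithin] at h2
  exact congrArg (fun L : ℝ →L[ℝ] EuclideanSpace ℝ (Fin n) ↦ L 1) (h1.trans h2)

/-- In a chart, the chord from `γ a` to a nearby `γ s` has direction close to the timelike initial
velocity. This persists when `γ a` is moved slightly, so a straight segment reaches `γ s`, and the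
rest of `γ` leads on to `q`. -/
theorem ArcJoined.eventually_left {p q : V} (hpq : g.ArcJoined p q) :
    ∀ᶠ p' in 𝓝 p, ∃ m, g.ArcJoined p' m ∧ g.ArcJoined m q := by
  obtain ⟨γ, a, b, hγ, rfl, rfl⟩ := hpq
  have hab := hγ.1
  obtain ⟨w, hw, hwt⟩ := hγ.exists_hasDerivWithinAt (left_mem_Icc.2 hab.le)
  set φ := extChartAt (𝓡 n) (γ a) with hφ
  have hsrc : γ a ∈ φ.source := mem_extChartAt_source (γ a)
  obtain ⟨r, hr, H⟩ := exists_ball_arcJoined (φ.map_source hsrc) hwt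
  -- The open interval excludes `a`, as the slope criterion requires, and keeps `s < b` so that a
  -- final arc remains.
  have hw' := hw.mono Ioo_subset_Icc_self
  have hγc : Filter.Tendsto γ (𝓝[Ioo a b] a) (𝓝 (γ a)) :=
    (hγ.2.1.continuousOn a (left_mem_Icc.2 hab.le)).mono Ioo_subset_Icc_self
  have hne : (𝓝[Ioo a b] a).NeBot := left_nhdsWithin_Ioo_neBot hab
  obtain ⟨s, hs, hslope, hball, hssrc⟩ := ((eventually_mem_nhdsWithin).and
    ((((hasDerivWithinAt_iff_tendsto_slope' (by simp)).1 hw').eventually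
      (Metric.ball_mem_nhds w hr)).and ((hw'.continuousWithinAt.eventually
      (Metric.ball_mem_nhds _ hr)).and
        (hγc.eventually (extChartAt_source_mem_nhds (I := 𝓡 n) (γ a)))))).exists
  have hpos : 0 < s - a := sub_pos.2 hs.1
  have hφc : ContinuousAt φ (γ a) := continuousAt_extChartAt (γ a)
  have hcw : ContinuousAt (fun p' ↦ (s - a)⁻¹ • (φ (γ s) - φ p')) (γ a) := by fun_prop
  filter_upwards [extChartAt_source_mem_nhds (I := 𝓡 n) (γ a),
    hφc.eventually (Metric.ball_mem_nhds _ hr),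
    hcw.eventually (Metric.isOpen_ball.mem_nhds hslope)] with p' h1 h2 h3
  have hend : φ p' + (s - a) • ((s - a)⁻¹ • (φ (γ s) - φ p')) = φ (γ s) := by
    rw [smul_inv_smul₀ hpos.ne', add_sub_cancel]
  have := H (φ p') _ (s - a) hpos h2 (by rw [hend]; exact hball) h3
  rw [hend, φ.left_inv h1, φ.left_inv hssrc] at this
  exact ⟨γ s, this, γ, s, b, hγ.mono hs.1.le hs.2 le_rfl, rfl, rfl⟩

theorem ArcJoined.eventually_right {p q : V} (hpq : g.ArcJoined p q) :
    ∀ᶠ q' in 𝓝 q, ∃ m, g.ArcJoined p m ∧ g.ArcJoined m q' := by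
  obtain ⟨γ, a, b, hγ, rfl, rfl⟩ := hpq
  have hab := hγ.1
  obtain ⟨w, hw, hwt⟩ := hγ.exists_hasDerivWithinAt (right_mem_Icc.2 hab.le)
  set φ := extChartAt (𝓡 n) (γ b) with hφ
  have hsrc : γ b ∈ φ.source := mem_extChartAt_source (γ b)
  obtain ⟨r, hr, H⟩ := exists_ball_arcJoined (φ.map_source hsrc) hwt
  have hw' := hw.mono Ioo_subset_Icc_self
  have hγc : Filter.Tendsto γ (𝓝[Ioo a b] b) (𝓝 (γ b)) :=
    (hγ.2.1.continuousOn b (right_mem_Icc.2 hab.le)).mono Ioo_subset_Icc_self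
  have hne : (𝓝[Ioo a b] b).NeBot := right_nhdsWithin_Ioo_neBot hab
  obtain ⟨s, hs, hslope, hball, hssrc⟩ := ((eventually_mem_nhdsWithin).and
    ((((hasDerivWithinAt_iff_tendsto_slope' (by simp)).1 hw').eventually
      (Metric.ball_mem_nhds w hr)).and ((hw'.continuousWithinAt.eventually
      (Metric.ball_mem_nhds _ hr)).and
        (hγc.eventually (extChartAt_source_mem_nhds (I := 𝓡 n) (γ b)))))).exists
  have hpos : 0 < b - s := sub_pos.2 hs.2
  have hφc : ContinuousAt φ (γ b) := continuousAt_extChartAt (γ b)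
  have hcw : ContinuousAt (fun q' ↦ (b - s)⁻¹ • (φ q' - φ (γ s))) (γ b) := by fun_prop
  -- The slope based at `b` is turned into the direction of the chord from `γ s` to `γ b`.
  rw [slope_comm] at hslope
  filter_upwards [extChartAt_source_mem_nhds (I := 𝓡 n) (γ b),
    hφc.eventually (Metric.ball_mem_nhds _ hr),
    hcw.eventually (Metric.isOpen_ball.mem_nhds hslope)] with q' h1 h2 h3
  have hend : φ (γ s) + (b - s) • ((b - s)⁻¹ • (φ q' - φ (γ s))) = φ q' := by
    rw [smul_inv_smul₀ hpos.ne', add_sub_cancel]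
  have := H (φ (γ s)) _ (b - s) hpos hball (by rw [hend]; exact h2) h3
  rw [hend, φ.left_inv h1, φ.left_inv hssrc] at this
  exact ⟨γ s, ⟨γ, a, s, hγ.mono le_rfl hs.1 hs.2.le, rfl, rfl⟩, this⟩

/-- Only the first arc of a chain sees the starting point, so it alone has to be perturbed. -/
theorem chronPast_mem_nhds {p q : V} (hpq : g.ChronIn univ p q) : g.chronPast q ∈ 𝓝 p := by
  obtain ⟨y, hpy, hyq⟩ := Relation.TransGen.head'_iff.1 (chronIn_univ_iff_transGen.1 hpq)
  filter_upwards [hpy.eventually_left] with p' ⟨m, h1, h2⟩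
  exact chronIn_univ_iff_transGen.2 (.head h1 (.head' h2 hyq))

theorem chronFuture_mem_nhds {p q : V} (hpq : g.ChronIn univ p q) : g.chronFuture p ∈ 𝓝 q := by
  obtain ⟨y, hpy, hyq⟩ := Relation.TransGen.tail'_iff.1 (chronIn_univ_iff_transGen.1 hpq)
  filter_upwards [hyq.eventually_right] with q' ⟨m, h1, h2⟩
  exact chronIn_univ_iff_transGen.2 (.tail (.tail' hpy h1) h2)

variable (g) in
-- A short chart segment from `x` in the direction of the time field stays in `U` and is timelike.
theorem exists_mem_chronFuture (x : V) {U : Set V} (hU : U ∈ 𝓝 x) :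
    ∃ y ∈ U, g.ChronIn univ x y := by
  set φ := extChartAt (𝓡 n) x with hφ
  have hsrc : x ∈ φ.source := mem_extChartAt_source x
  have hz := φ.map_source hsrc
  obtain ⟨w, hw⟩ := chartSymmDeriv_surjective x hz (g.timeField _)
  obtain ⟨r, hr, H⟩ := exists_ball_arcJoined (g := g) (w₀ := w) hz
    (hw ▸ g.isFutureTimelike_timeField _)
  have hl : Filter.Tendsto (fun δ : ℝ ↦ φ x + δ • w) (𝓝[>] 0) (𝓝 (φ x)) := by
    have : ContinuousAt (fun δ : ℝ ↦ φ x + δ • w) 0 := by fun_prop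
    simpa using this.tendsto.mono_left nhdsWithin_le_nhds
  have hsymm : Filter.Tendsto φ.symm (𝓝 (φ x)) (𝓝 x) := by
    have := (continuousAt_extChartAt_symm (I := 𝓡 n) x).tendsto
    rwa [extChartAt_to_inv] at this
  obtain ⟨δ, hδ, h1, h2⟩ := (eventually_mem_nhdsWithin.and
    ((hl.eventually (Metric.ball_mem_nhds _ hr)).and ((hsymm.comp hl).eventually hU))).exists
  have := H (φ x) w δ hδ (by simpa using hr) h1 (by simpa using hr)
  rw [φ.left_inv hsrc] at this
  exact ⟨_, h2, chronIn_univ_iff_transGen.2 (.single this)⟩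

variable (g) in
theorem exists_mem_chronPast (x : V) {U : Set V} (hU : U ∈ 𝓝 x) :
    ∃ y ∈ U, g.ChronIn univ y x := by
  set φ := extChartAt (𝓡 n) x with hφ
  have hsrc : x ∈ φ.source := mem_extChartAt_source x
  have hz := φ.map_source hsrc
  obtain ⟨w, hw⟩ := chartSymmDeriv_surjective x hz (g.timeField _)
  obtain ⟨r, hr, H⟩ := exists_ball_arcJoined (g := g) (w₀ := w) hz
    (hw ▸ g.isFutureTimelike_timeField _)
  have hl : Filter.Tendsto (fun δ : ℝ ↦ φ x - δ • w) (𝓝[>] 0) (𝓝 (φ x)) := by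
    have : ContinuousAt (fun δ : ℝ ↦ φ x - δ • w) 0 := by fun_prop
    simpa using this.tendsto.mono_left nhdsWithin_le_nhds
  have hsymm : Filter.Tendsto φ.symm (𝓝 (φ x)) (𝓝 x) := by
    have := (continuousAt_extChartAt_symm (I := 𝓡 n) x).tendsto
    rwa [extChartAt_to_inv] at this
  obtain ⟨δ, hδ, h1, h2⟩ := (eventually_mem_nhdsWithin.and
    ((hl.eventually (Metric.ball_mem_nhds _ hr)).and ((hsymm.comp hl).eventually hU))).exists
  have := H (φ x - δ • w) w δ hδ h1 (by simpa using hr) (by simpa using hr)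
  rw [sub_add_cancel, φ.left_inv hsrc] at this
  exact ⟨_, h2, chronIn_univ_iff_transGen.2 (.single this)⟩

theorem ChronIn.trans {p q r : V} (hpq : g.ChronIn univ p q) (hqr : g.ChronIn univ q r) :
    g.ChronIn univ p r :=
  chronIn_univ_iff_transGen.2
    ((chronIn_univ_iff_transGen.1 hpq).trans (chronIn_univ_iff_transGen.1 hqr))

/-! ### The distinguishing condition. -/

namespace IsCausalMap

variable {h} {Φ : V ≃ₘ^∞⟮𝓡 n, 𝓡 n⟯ W}

/-- For `z` in `I⁺(Φ x)`, the open set `I⁻(z)` contains `Φ x'` for some `x'` in `I⁺(x)` near `x`.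
Then `x'` is in `I⁺(y)`, and `z` is reached from `Φ y` through `Φ x'`. -/
theorem chronFuture_subset (hΦ : g.IsCausalMap h Φ) {x y : V}
    (hxy : g.chronFuture x ⊆ g.chronFuture y) :
    h.chronFuture (Φ x) ⊆ h.chronFuture (Φ y) := by
  intro z hz
  obtain ⟨x', h1, h2⟩ := g.exists_mem_chronFuture x
    (Φ.continuous.continuousAt.preimage_mem_nhds (chronPast_mem_nhds hz))
  exact (hΦ.chronIn_univ (hxy h2)).trans h1

theorem chronPast_subset (hΦ : g.IsCausalMap h Φ) {x y : V}
    (hxy : g.chronPast x ⊆ g.chronPast y) : h.chronPast (Φ x) ⊆ h.chronPast (Φ y) := by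
  intro z hz
  obtain ⟨x', h1, h2⟩ := g.exists_mem_chronPast x
    (Φ.continuous.continuousAt.preimage_mem_nhds (chronFuture_mem_nhds hz))
  exact ChronIn.trans h1 (hΦ.chronIn_univ (hxy h2))

theorem distinguishing (hΦ : g.IsCausalMap h Φ) (hh : h.Distinguishing) : g.Distinguishing :=
  ⟨fun _ _ hxy ↦ Φ.injective <| hh.1 _ _ <|
    (hΦ.chronFuture_subset hxy.subset).antisymm (hΦ.chronFuture_subset hxy.symm.subset),
  fun _ _ hxy ↦ Φ.injective <| hh.2 _ _ <|
    (hΦ.chronPast_subset hxy.subset).antisymm (hΦ.chronPast_subset hxy.symm.subset)⟩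

end IsCausalMap

end Spacetime

end

/-! ### The theorem and its contrapositive. -/

theorem theorem4p3 {n : ℕ}
    {V : Type*} [TopologicalSpace V] [T2Space V] [ConnectedSpace V]
    [ChartedSpace (EuclideanSpace ℝ (Fin n)) V] [IsManifold (𝓡 n) ∞ V]
    {W : Type*} [TopologicalSpace W] [T2Space W] [ConnectedSpace W]
    [ChartedSpace (EuclideanSpace ℝ (Fin n)) W] [IsManifold (𝓡 n) ∞ W]
    (g : Spacetime n V) (h : Spacetime n W) :
    (g.Precedes h →
      (h.GloballyHyperbolic → g.GloballyHyperbolic) ∧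
      (h.CausallyStable → g.CausallyStable) ∧
      (h.StronglyCausal → g.StronglyCausal) ∧
      (h.Distinguishing → g.Distinguishing) ∧
      (h.Causal → g.Causal) ∧
      (h.Chronological → g.Chronological) ∧
      (h.NotTotallyVicious → g.NotTotallyVicious)) ∧
    ((h.GloballyHyperbolic ∧ ¬ g.GloballyHyperbolic) ∨
      (h.CausallyStable ∧ ¬ g.CausallyStable) ∨
      (h.StronglyCausal ∧ ¬ g.StronglyCausal) ∨
      (h.Distinguishing ∧ ¬ g.Distinguishing) ∨
      (h.Causal ∧ ¬ g.Causal) ∨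
      (h.Chronological ∧ ¬ g.Chronological) ∨
      (h.NotTotallyVicious ∧ ¬ g.NotTotallyVicious) →
        ¬ g.Precedes h) := by
  have key : g.Precedes h →
      (h.GloballyHyperbolic → g.GloballyHyperbolic) ∧
      (h.CausallyStable → g.CausallyStable) ∧
      (h.StronglyCausal → g.StronglyCausal) ∧
      (h.Distinguishing → g.Distinguishing) ∧
      (h.Causal → g.Causal) ∧
      (h.Chronological → g.Chronological) ∧
      (h.NotTotallyVicious → g.NotTotallyVicious) := by
    rintro ⟨Φ, hΦ⟩
    have hΦ : g.IsCausalMap h Φ := hΦ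
    exact ⟨hΦ.globallyHyperbolic, hΦ.causallyStable, hΦ.stronglyCausal, hΦ.distinguishing,
      hΦ.causal, hΦ.chronological, hΦ.notTotallyVicious⟩
  refine ⟨key, fun hne hprec ↦ ?_⟩
  obtain ⟨h1, h2, h3, h4, h5, h6, h7⟩ := key hprec
  rcases hne with ⟨hW, hV⟩ | ⟨hW, hV⟩ | ⟨hW, hV⟩ | ⟨hW, hV⟩ | ⟨hW, hV⟩ | ⟨hW, hV⟩ | ⟨hW, hV⟩
  exacts [hV (h1 hW), hV (h2 hW), hV (h3 hW), hV (h4 hW), hV (h5 hW), hV (h6 hW), hV (h7 hW)]
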